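/- Let $U:\mathcal E\to\mathcal B$ be a fibration, with fibre $\mathcal E_X$ (objects over $X$, morphisms over $\mathrm{id}_X$) for each object $X$ of $\mathcal B$, and with reindexing functors $f^*:\mathcal E_Y\to\mathcal E_X$ for $f:X\to Y$ in $\mathcal B$. $U$ is a *comprehension category with unit* if it is equipped with a truth functor $\top:\mathcal B\to\mathcal E$ that is right adjoint and right inverse to $U$ (that is, $U\dashv\top$, $U\top=\mathrm{Id}$, with identity counit) and with a comprehension functor $\{-\}:\mathcal E\to\mathcal B$ right adjoint to $\top$. The projection $\pi_P:\{P\}=U\top\{P\}\to UP$ is $U$ applied to the counit $\top\{P\}\to P$. It is *full* if the functor $\mathcal E\to\mathcal B^{\to}$, $P\mapsto\pi_P$, is full and faithful. $U$ is a *full cartesian Lawvere category* if it is a full comprehension category with unit and a bifibration, i.e. every $f^*$ has a left adjoint $\Sigma_f$ (coproducts). - $U$ *has products* if every $f^*$ has a right adjoint $\Pi_f$. - The coproducts are *very strong* if, for all $f:X\to Y$ and $P\in\mathcal E_X$, the map $\{\psi\}:\{P\}\to\{\Sigma_fP\}$ is an isomorphism, where $\psi:P\to f^*\Sigma_fP\to\Sigma_fP$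 is the unit followed by the cartesian morphism over $f$. - The coproducts satisfy the *Beck–Chevalley condition* if, for every pullback square $f\circ i=g\circ j$ in $\mathcal B$, with $i:W\to X$, $j:W\to Y$, $f:X\to Z$, $g:Y\to Z$, the canonical natural transformation $\Sigma_j\,i^*\Rightarrow g^*\,\Sigma_f$ is an isomorphism. For an object $A$ of $\mathcal B$, let $U^A:\mathcal E_A\times_{\mathcal B}\mathcal E\to\mathcal E_A$ be the change of base of $U$ along the comprehension functor restricted to the fibre, i.e. the (strict) pullback in the category of categories of $U:\mathcal E\to\mathcal B$ along $\{-\}:\mathcal E_A\to\mathcal B$. **Theorem.** If $U$ is a full cartesian Lawvere category with products and with very strong coproducts satisfying the Beck–Chevalley condition for coproducts, then for every object $A$ of $\mathcal B$ the functor $U^A$ also carries the structure of a full cartesian Lawvere category with products and with very strong coproducts satisfying the Beck–Chevalley condition for coproducts. -/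

import Mathlib

open CategoryTheory

universe v₁ v₂ v₃ u₁ u₂ u₃

noncomputable section

namespace FibredRefinement

variable {B : Type u₁} [Category.{v₁} B] {E : Type u₂} [Category.{v₂} E]

/-! ### Reindexing along a morphism of the base of a fibration -/

/-- The object of `E` underlying an object of the fibre over `X`. -/
abbrev tot {U : E ⥤ B} {X : B} (P : U.Fiber X) : E :=
  Functor.Fiber.fiberInclusion.obj P

/-- The morphism of `E` underlying a morphism of the fibre over `X`. -/
abbrev totMap {U : E ⥤ B} {X : B} {P Q : U.Fiber X} (φ : P ⟶ Q) : tot P ⟶ tot Q :=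
  Functor.Fiber.fiberInclusion.map φ

theorem totMap_comp {U : E ⥤ B} {X : B} {P Q R : U.Fiber X} (φ : P ⟶ Q) (ψ : Q ⟶ R) :
    totMap (φ ≫ ψ) = totMap φ ≫ totMap ψ :=
  rfl

/-- The object `f^* P` of the fibre over `X`, for `f : X ⟶ Y` and `P` over `Y`. -/
def reindexObj (U : E ⥤ B) [U.IsFibered] {X Y : B} (f : X ⟶ Y) (P : U.Fiber Y) : U.Fiber X :=
  Functor.Fiber.mk (Functor.IsPreFibered.pullbackObj_proj P.2 f)

/-- The chosen cartesian morphism `f^* P ⟶ P` over `f`. -/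
def cartLift (U : E ⥤ B) [U.IsFibered] {X Y : B} (f : X ⟶ Y) (P : U.Fiber Y) :
    tot (reindexObj U f P) ⟶ tot P :=
  Functor.IsPreFibered.pullbackMap P.2 f

instance cartLift_isCartesian (U : E ⥤ B) [U.IsFibered] {X Y : B} (f : X ⟶ Y) (P : U.Fiber Y) :
    U.IsCartesian f (cartLift U f P) :=
  Functor.IsPreFibered.pullbackMap.IsCartesian P.2 f

/-- The action of `f^*` on a vertical morphism: the unique vertical morphism which commutes
with the cartesian morphisms. -/
def reindexMap (U : E ⥤ B) [U.IsFibered] {X Y : B} (f : X ⟶ Y) {P Q : U.Fiber Y} (φ : P ⟶ Q) :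
    reindexObj U f P ⟶ reindexObj U f Q :=
  Functor.Fiber.homMk U X
    (Functor.IsCartesian.map U f (cartLift U f Q) (cartLift U f P ≫ totMap φ))

theorem reindexMap_fac (U : E ⥤ B) [U.IsFibered] {X Y : B} (f : X ⟶ Y) {P Q : U.Fiber Y}
    (φ : P ⟶ Q) : totMap (reindexMap U f φ) ≫ cartLift U f Q = cartLift U f P ≫ totMap φ :=
  Functor.IsCartesian.fac U f (cartLift U f Q) (cartLift U f P ≫ totMap φ)

theorem fiberHom_ext_of_cartesian (U : E ⥤ B) {X Y : B} (f : X ⟶ Y) {R P : U.Fiber X} {b : E}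
    (c : tot P ⟶ b) [U.IsCartesian f c] (φ ψ : R ⟶ P) (h : totMap φ ≫ c = totMap ψ ≫ c) :
    φ = ψ :=
  Functor.Fiber.hom_ext (Functor.IsCartesian.ext U f c _ _ h)

/-- The reindexing functor `f^* : E_Y ⥤ E_X` of a fibration `U : E ⥤ B` along `f : X ⟶ Y`. -/
def reindex (U : E ⥤ B) [U.IsFibered] {X Y : B} (f : X ⟶ Y) : U.Fiber Y ⥤ U.Fiber X where
  obj P := reindexObj U f P
  map φ := reindexMap U f φ
  map_id P := by
    apply fiberHom_ext_of_cartesian U f (cartLift U f P)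
    simp [reindexMap_fac]
  map_comp {P Q R} φ ψ := by
    apply fiberHom_ext_of_cartesian U f (cartLift U f R)
    rw [reindexMap_fac, totMap_comp, totMap_comp, Category.assoc, reindexMap_fac,
      ← Category.assoc, ← Category.assoc, reindexMap_fac]

/-- For a commutative square `i ≫ f = j ≫ g`, the canonical (invertible) vertical morphism
`i^* f^* P ⟶ j^* g^* P` which commutes with the composite cartesian morphisms to `P`. -/
def reindexSquareApp (U : E ⥤ B) [U.IsFibered] {W X Y Z : B}
    {i : W ⟶ X} {j : W ⟶ Y} {f : X ⟶ Z} {g : Y ⟶ Z} (h : i ≫ f = j ≫ g) (P : U.Fiber Z) :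
    reindexObj U i (reindexObj U f P) ⟶ reindexObj U j (reindexObj U g P) :=
  haveI : U.IsHomLift (j ≫ g) (cartLift U i (reindexObj U f P) ≫ cartLift U f P) :=
    h ▸ (inferInstance : U.IsHomLift (i ≫ f) (cartLift U i (reindexObj U f P) ≫ cartLift U f P))
  Functor.Fiber.homMk U W
    (Functor.IsCartesian.map U (j ≫ g) (cartLift U j (reindexObj U g P) ≫ cartLift U g P)
      (cartLift U i (reindexObj U f P) ≫ cartLift U f P))

theorem reindexSquareApp_fac (U : E ⥤ B) [U.IsFibered] {W X Y Z : B}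
    {i : W ⟶ X} {j : W ⟶ Y} {f : X ⟶ Z} {g : Y ⟶ Z} (h : i ≫ f = j ≫ g) (P : U.Fiber Z) :
    totMap (reindexSquareApp U h P) ≫ cartLift U j (reindexObj U g P) ≫ cartLift U g P =
      cartLift U i (reindexObj U f P) ≫ cartLift U f P :=
  haveI : U.IsHomLift (j ≫ g) (cartLift U i (reindexObj U f P) ≫ cartLift U f P) :=
    h ▸ (inferInstance : U.IsHomLift (i ≫ f) (cartLift U i (reindexObj U f P) ≫ cartLift U f P))
  Functor.IsCartesian.fac U (j ≫ g) (cartLift U j (reindexObj U g P) ≫ cartLift U g P) _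

/-- The canonical comparison `i^* f^* ⟶ j^* g^*` for a commutative square `i ≫ f = j ≫ g`. -/
def reindexSquare (U : E ⥤ B) [U.IsFibered] {W X Y Z : B}
    {i : W ⟶ X} {j : W ⟶ Y} {f : X ⟶ Z} {g : Y ⟶ Z} (h : i ≫ f = j ≫ g) :
    reindex U f ⋙ reindex U i ⟶ reindex U g ⋙ reindex U j where
  app P := reindexSquareApp U h P
  naturality P Q φ := by
    apply fiberHom_ext_of_cartesian U (j ≫ g)
      (cartLift U j (reindexObj U g Q) ≫ cartLift U g Q)
    have h₁ : totMap (reindexMap U i (reindexMap U f φ)) ≫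
        cartLift U i (reindexObj U f Q) ≫ cartLift U f Q =
        (cartLift U i (reindexObj U f P) ≫ cartLift U f P) ≫ totMap φ := by
      rw [← Category.assoc, reindexMap_fac, Category.assoc, reindexMap_fac, Category.assoc]
    have h₂ : totMap (reindexMap U j (reindexMap U g φ)) ≫
        cartLift U j (reindexObj U g Q) ≫ cartLift U g Q =
        (cartLift U j (reindexObj U g P) ≫ cartLift U g P) ≫ totMap φ := by
      rw [← Category.assoc, reindexMap_fac, Category.assoc, reindexMap_fac, Category.assoc]
    change totMap (reindexMap U i (reindexMap U f φ) ≫ reindexSquareApp U h Q) ≫ _ =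
      totMap (reindexSquareApp U h P ≫ reindexMap U j (reindexMap U g φ)) ≫ _
    rw [totMap_comp, totMap_comp, Category.assoc, Category.assoc, reindexSquareApp_fac,
      h₁, h₂, ← Category.assoc (totMap (reindexSquareApp U h P)), reindexSquareApp_fac]

/-! ### Comprehension categories with unit, Lawvere categories -/

/-- The structure of a comprehension category with unit on a functor `U : E ⥤ B`: `U` is a
fibration, it has a truth functor `⊤` which is right adjoint and right inverse to `U` (so that
`⊤ X` is terminal in the fibre over `X`), and `⊤` has a right adjoint, the comprehension
functor. -/
structure ComprehensionCategoryWithUnit (U : E ⥤ B) where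
  isFibered : U.IsFibered
  /-- the truth functor `⊤` -/
  truth : B ⥤ E
  truth_comp : truth ⋙ U = 𝟭 B
  /-- the adjunction `U ⊣ ⊤` -/
  truthAdj : U ⊣ truth
  truthAdj_counit : truthAdj.counit = eqToHom truth_comp
  /-- the comprehension functor `{-}` -/
  compr : E ⥤ B
  /-- the adjunction `⊤ ⊣ {-}` -/
  comprAdj : truth ⊣ compr

namespace ComprehensionCategoryWithUnit

variable {U : E ⥤ B} (L : ComprehensionCategoryWithUnit U)

/-- The projection `π : {-} ⟶ U`: its component at `P` is `U` applied to the counit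
`⊤{P} ⟶ P`, where `U ⊤ {P} = {P}`. -/
def proj : L.compr ⟶ U where
  app P := eqToHom (Functor.congr_obj L.truth_comp (L.compr.obj P)).symm ≫
    U.map (L.comprAdj.counit.app P)
  naturality P Q φ := by
    have h := Functor.congr_hom L.truth_comp (L.compr.map φ)
    have h2 := congrArg U.map (L.comprAdj.counit.naturality φ)
    simp only [Functor.comp_map, Functor.map_comp, Functor.id_map] at h h2
    rw [Category.assoc, ← h2, h]
    simp

/-- The functor `E ⥤ B^→` induced by the projection `π : {-} ⟶ U`. -/
def toArrow : E ⥤ Arrow B where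
  obj P := Arrow.mk (L.proj.app P)
  map φ := Arrow.homMk (L.compr.map φ) (U.map φ) (L.proj.naturality φ)

/-- Fullness of a comprehension category: `P ↦ π_P` is full and faithful as a functor
to the arrow category. -/
def IsFull : Prop :=
  L.toArrow.Full ∧ L.toArrow.Faithful

/-- The restriction `{-} : E_A ⥤ B` of the comprehension functor to the fibre over `A`. -/
def fiberCompr (A : B) : U.Fiber A ⥤ B :=
  Functor.Fiber.fiberInclusion ⋙ L.compr

end ComprehensionCategoryWithUnit

/-- The structure of a full cartesian Lawvere category on `U : E ⥤ B`: a full comprehension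
category with unit which is a bifibration, i.e. every reindexing functor `f^*` has a left
adjoint `Σ_f`. -/
structure FullCartesianLawvereCategory (U : E ⥤ B) extends ComprehensionCategoryWithUnit U where
  isFull : toComprehensionCategoryWithUnit.IsFull
  isRightAdjoint_reindex {X Y : B} (f : X ⟶ Y) : (reindex U f).IsRightAdjoint

namespace FullCartesianLawvereCategory

variable {U : E ⥤ B} (L : FullCartesianLawvereCategory U)

/-- The functor `f^* : E_Y ⥤ E_X`. -/
def pull {X Y : B} (f : X ⟶ Y) : U.Fiber Y ⥤ U.Fiber X :=
  haveI := L.isFibered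
  reindex U f

/-- The indexed coproduct (op-reindexing) functor `Σ_f : E_X ⥤ E_Y`. -/
def sigma {X Y : B} (f : X ⟶ Y) : U.Fiber X ⥤ U.Fiber Y :=
  haveI : (L.pull f).IsRightAdjoint := L.isRightAdjoint_reindex f
  (L.pull f).leftAdjoint

/-- The adjunction `Σ_f ⊣ f^*`. -/
def sigmaAdj {X Y : B} (f : X ⟶ Y) : L.sigma f ⊣ L.pull f :=
  haveI : (L.pull f).IsRightAdjoint := L.isRightAdjoint_reindex f
  Adjunction.ofIsRightAdjoint (L.pull f)

/-- The canonical morphism `ψ : P ⟶ Σ_f P` over `f`: the unit `P ⟶ f^* Σ_f P` followed by the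
cartesian morphism `f^* Σ_f P ⟶ Σ_f P`. -/
def sigmaMap {X Y : B} (f : X ⟶ Y) (P : U.Fiber X) : tot P ⟶ tot ((L.sigma f).obj P) :=
  haveI := L.isFibered
  totMap ((L.sigmaAdj f).unit.app P) ≫ cartLift U f ((L.sigma f).obj P)

/-- Coproducts are very strong: `{ψ} : {P} ⟶ {Σ_f P}` is always an isomorphism. -/
def VeryStrongCoproducts : Prop :=
  ∀ ⦃X Y : B⦄ (f : X ⟶ Y) (P : U.Fiber X), IsIso (L.compr.map (L.sigmaMap f P))

/-- `U` has products: every reindexing functor `f^*` has a right adjoint `Π_f`. -/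
def HasProducts : Prop :=
  ∀ ⦃X Y : B⦄ (f : X ⟶ Y), (L.pull f).IsLeftAdjoint

/-- For a commutative square `i ≫ f = j ≫ g`, the canonical natural transformation
`Σ_j i^* ⟶ g^* Σ_f`, i.e. the mate of the canonical comparison `i^* f^* ⟶ j^* g^*`. -/
def beckChevalleyMap {W X Y Z : B} {i : W ⟶ X} {j : W ⟶ Y} {f : X ⟶ Z} {g : Y ⟶ Z}
    (h : i ≫ f = j ≫ g) : L.pull i ⋙ L.sigma j ⟶ L.sigma f ⋙ L.pull g :=
  haveI := L.isFibered
  ((mateEquiv (L.sigmaAdj f) (L.sigmaAdj j)).symm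
    (TwoSquare.mk _ _ _ _ (reindexSquare U h))).natTrans

/-- The Beck-Chevalley condition for coproducts: for every pullback square in the base, the
canonical natural transformation `Σ_j i^* ⟶ g^* Σ_f` is an isomorphism. -/
def BeckChevalley : Prop :=
  ∀ ⦃W X Y Z : B⦄ ⦃i : W ⟶ X⦄ ⦃j : W ⟶ Y⦄ ⦃f : X ⟶ Z⦄ ⦃g : Y ⟶ Z⦄ (h : IsPullback i j f g),
    IsIso (L.beckChevalleyMap h.w)

end FullCartesianLawvereCategory

/-! ### Change of base -/

/-- Objects of the (strict) pullback `C ×_B E` in `Cat` of `K : C ⥤ B` and `U : E ⥤ B`: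
pairs `(P, Y)` with `U Y = K P`. -/
structure StrictPullback {C : Type u₃} [Category.{v₃} C] (K : C ⥤ B) (U : E ⥤ B) where
  fst : C
  snd : E
  w : U.obj snd = K.obj fst

namespace StrictPullback

variable {C : Type u₃} [Category.{v₃} C] {K : C ⥤ B} {U : E ⥤ B}

/-- Morphisms of the strict pullback: pairs `(α, β)` with `U β = K α` (modulo the
identifications of objects). -/
@[ext]
structure Hom (S T : StrictPullback K U) where
  fst : S.fst ⟶ T.fst
  snd : S.snd ⟶ T.snd
  w : U.IsHomLift (K.map fst) snd

instance : Category (StrictPullback K U) where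
  Hom S T := Hom S T
  id S := ⟨𝟙 S.fst, 𝟙 S.snd, by rw [K.map_id]; exact IsHomLift.id S.w⟩
  comp φ ψ := ⟨φ.fst ≫ ψ.fst, φ.snd ≫ ψ.snd, by
    have := φ.w
    have := ψ.w
    rw [K.map_comp]
    infer_instance⟩
  id_comp φ := Hom.ext (Category.id_comp _) (Category.id_comp _)
  comp_id φ := Hom.ext (Category.comp_id _) (Category.comp_id _)
  assoc φ ψ χ := Hom.ext (Category.assoc _ _ _) (Category.assoc _ _ _)

end StrictPullback

/-- The functor `C ×_B E ⥤ C` obtained from `U : E ⥤ B` by change of base along `K : C ⥤ B`. -/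
def changeOfBase {C : Type u₃} [Category.{v₃} C] (K : C ⥤ B) (U : E ⥤ B) :
    StrictPullback K U ⥤ C where
  obj S := S.fst
  map φ := φ.fst

/-- The functor `U^A : E_A ×_B E ⥤ E_A`, the change of base of `U` along the comprehension
functor `{-} : E_A ⥤ B`. -/
def indexedFibration {U : E ⥤ B} (L : ComprehensionCategoryWithUnit U) (A : B) :
    StrictPullback (L.fiberCompr A) U ⥤ U.Fiber A :=
  changeOfBase (L.fiberCompr A) U

end FibredRefinement

end

namespace FibredRefinement

noncomputable section

variable {B : Type u₁} [Category.{v₁} B] {E : Type u₂} [Category.{v₂} E]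

/-! ### Change of base: cartesian and cocartesian morphisms -/

/-! Fullness makes `{-} : E_A ⥤ B` a full subcategory of the slice over `A`: a vertical map `P ⟶ Q`
is the same as a map `{P} ⟶ {Q}` commuting with the projections to `A`. An object of the strict
pullback is a pair `(P, Q)` with `Q` over `{P}`, and the composite `{Q} ⟶ {P} ⟶ A` should be its
comprehension. Very strong coproducts put this composite back in `E_A`, since `{Q} ≅ {Σ_{π_P} Q}`
over `A`; so `Σ_{π_P} Q` serves as the comprehension of `(P, Q)`. `SumClosed` isolates exactly what
this argument uses, and yields the unit, the comprehension and its fullness.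

The bifibration part is transport: the fibre of `U^A` over `P` is equivalent to the fibre of `U`
over `{P}`, compatibly with reindexing (`reindexFiberFunctorIso`), so both adjoints of reindexing
carry over.

The chosen coproducts of `U^A` need not match those of `U`, so the last two properties are first
restated for arbitrary (co)cartesian morphisms (`VeryStrongCoproducts.isIso_map`,
`BeckChevalley.isCocartesian`, `beckChevalley_of_isCocartesian`), which are then compared through
second components. Beck–Chevalley further needs `{-} : E_A ⥤ B` to preserve pullbacks
(`isPullback_fiberCompr`). -/

theorem isHomLift_unique (U : E ⥤ B) {X Y : B} {a b : E} (f g : X ⟶ Y) (φ : a ⟶ b)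
    [U.IsHomLift f φ] [U.IsHomLift g φ] : f = g := by
  rw [IsHomLift.fac U f φ, IsHomLift.fac U g φ]

namespace StrictPullback

variable {C : Type u₃} [Category.{v₃} C] {K : C ⥤ B} {U : E ⥤ B}

theorem hom_ext {S T : StrictPullback K U} {φ ψ : S ⟶ T} (h₁ : φ.fst = ψ.fst)
    (h₂ : φ.snd = ψ.snd) : φ = ψ :=
  Hom.ext h₁ h₂

theorem isHomLift_of_fst_eq {S T : StrictPullback K U} {α : S.fst ⟶ T.fst} {φ : S ⟶ T}
    (h : φ.fst = α) : (changeOfBase K U).IsHomLift α φ := by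
  subst h
  exact IsHomLift.map (changeOfBase K U) φ

theorem fst_eq {S T : StrictPullback K U} (α : S.fst ⟶ T.fst) (φ : S ⟶ T)
    (h : (changeOfBase K U).IsHomLift α φ) : φ.fst = α :=
  (@IsHomLift.eq_of_isHomLift _ _ _ _ (changeOfBase K U) S T α φ h).symm

theorem isHomLift_snd {S T : StrictPullback K U} {X Y : C} (α : X ⟶ Y) (φ : S ⟶ T)
    [h : (changeOfBase K U).IsHomLift α φ] : U.IsHomLift (K.map α) φ.snd := by
  obtain ⟨⟩ := h
  exact φ.w

theorem isHomLift_id_snd {S T : StrictPullback K U} {X : C} (φ : S ⟶ T)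
    (h : (changeOfBase K U).IsHomLift (𝟙 X) φ) : U.IsHomLift (𝟙 (K.obj X)) φ.snd := by
  simpa using isHomLift_snd (𝟙 X) φ

/-- In a factorization through `φ` the first component is prescribed, so only the second must be
found, and it is a factorization over `K.map g` in `E`. -/
theorem isStronglyCartesian_of_snd {S T : StrictPullback K U} (φ : S ⟶ T)
    [hc : U.IsStronglyCartesian (K.map φ.fst) φ.snd] :
    (changeOfBase K U).IsStronglyCartesian φ.fst φ := by
  have key : ∀ {S' : StrictPullback K U} (g : S'.fst ⟶ S.fst) (φ' : S' ⟶ T),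
      φ'.fst = g ≫ φ.fst → ∃! χ : S' ⟶ S, χ.fst = g ∧ χ ≫ φ = φ' := by
    intro S' g φ' hfst
    have hw : U.IsHomLift (K.map φ'.fst) φ'.snd := φ'.w
    have hK : K.map φ'.fst = K.map g ≫ K.map φ.fst := by rw [hfst, K.map_comp]
    obtain ⟨χ, ⟨hχ, hχφ⟩, huniq⟩ := Functor.IsStronglyCartesian.universal_property U
      (K.map φ.fst) φ.snd (K.map g) (K.map φ'.fst) hK φ'.snd
    refine ⟨⟨g, χ, hχ⟩, ⟨rfl, hom_ext hfst.symm hχφ⟩, ?_⟩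
    rintro ψ ⟨rfl, hψφ⟩
    exact hom_ext rfl (huniq ψ.snd ⟨ψ.w, congrArg Hom.snd hψφ⟩)
  refine @Functor.IsStronglyCartesian.mk _ _ _ _ _ _ _ _ _ _ _ (isHomLift_of_fst_eq rfl) ?_
  intro S' g φ' hφ'
  obtain ⟨χ, ⟨h₁, h₂⟩, huniq⟩ := key g φ' (fst_eq (S := S') (T := T) (g ≫ φ.fst) φ' hφ')
  exact ⟨χ, ⟨isHomLift_of_fst_eq h₁, h₂⟩, fun ψ hψ ↦ huniq ψ ⟨fst_eq (S := S') g ψ hψ.1, hψ.2⟩⟩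

/-- The object `(X, Q)` of the strict pullback, for `Q` in the fibre over `K X`. -/
def ofFiber (X : C) (Q : U.Fiber (K.obj X)) : StrictPullback K U :=
  ⟨X, tot Q, Q.2⟩

theorem changeOfBase_isFibered [U.IsFibered] : (changeOfBase K U).IsFibered := by
  apply Functor.IsFibered.of_exists_isStronglyCartesian
  intro T X
  change ∀ α : X ⟶ T.fst, _
  intro α
  obtain ⟨Y, b, w⟩ := T
  let Q : U.Fiber (K.obj Y) := ⟨b, w⟩
  let φ : ofFiber X (reindexObj U (K.map α) Q) ⟶ ⟨Y, b, w⟩ :=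
    ⟨α, cartLift U (K.map α) Q, (cartLift_isCartesian U (K.map α) Q).toIsHomLift⟩
  have : U.IsStronglyCartesian (K.map φ.fst) φ.snd :=
    Functor.IsFibered.isStronglyCartesian_of_isCartesian U (K.map α) (cartLift U (K.map α) Q)
  exact ⟨_, φ, isStronglyCartesian_of_snd φ⟩

/-- A test object `b'` lies over `K.obj S.fst`, so `(S.fst, b')` is an object of the strict pullback
and the universal property of `φ` applies to it. -/
theorem isCartesian_snd {S T : StrictPullback K U} {X Y : C} (α : X ⟶ Y) (φ : S ⟶ T)
    [h : (changeOfBase K U).IsCartesian α φ] : U.IsCartesian (K.map α) φ.snd where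
  toIsHomLift := isHomLift_snd α φ
  universal_property {b'} φ' hφ' := by
    obtain rfl : S.fst = X := IsHomLift.domain_eq (changeOfBase K U) α φ
    obtain rfl : T.fst = Y := IsHomLift.codomain_eq (changeOfBase K U) α φ
    let S' : StrictPullback K U := ⟨S.fst, b', IsHomLift.domain_eq U (K.map α) φ'⟩
    obtain ⟨χ, ⟨hχ, hχφ⟩, huniq⟩ := @Functor.IsCartesian.universal_property _ _ _ _ _ _ _ _ _ _ _ h
      S' ⟨α, φ', hφ'⟩ (isHomLift_of_fst_eq rfl)
    refine ⟨χ.snd, ⟨isHomLift_id_snd (X := S.fst) χ hχ, congrArg Hom.snd hχφ⟩, ?_⟩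
    rintro τ ⟨hτ, hτφ⟩
    refine congrArg Hom.snd (huniq ⟨𝟙 S.fst, τ, by rw [K.map_id]; exact hτ⟩
      ⟨isHomLift_of_fst_eq rfl, hom_ext ?_ hτφ⟩)
    exact (Category.id_comp _).trans (fst_eq α φ h.toIsHomLift)

theorem isCocartesian_snd {S T : StrictPullback K U} {X Y : C} (α : X ⟶ Y) (φ : S ⟶ T)
    [h : (changeOfBase K U).IsCocartesian α φ] : U.IsCocartesian (K.map α) φ.snd where
  toIsHomLift := isHomLift_snd α φ
  universal_property {b'} φ' hφ' := by
    obtain rfl : S.fst = X := IsHomLift.domain_eq (changeOfBase K U) α φ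
    obtain rfl : T.fst = Y := IsHomLift.codomain_eq (changeOfBase K U) α φ
    let T' : StrictPullback K U := ⟨T.fst, b', IsHomLift.codomain_eq U (K.map α) φ'⟩
    obtain ⟨χ, ⟨hχ, hχφ⟩, huniq⟩ :=
      @Functor.IsCocartesian.universal_property _ _ _ _ _ _ _ _ _ _ _ h
        T' ⟨α, φ', hφ'⟩ (isHomLift_of_fst_eq rfl)
    refine ⟨χ.snd, ⟨isHomLift_id_snd (X := T.fst) χ hχ, congrArg Hom.snd hχφ⟩, ?_⟩
    rintro τ ⟨hτ, hτφ⟩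
    refine congrArg Hom.snd (huniq ⟨𝟙 T.fst, τ, by rw [K.map_id]; exact hτ⟩
      ⟨isHomLift_of_fst_eq rfl, hom_ext ?_ hτφ⟩)
    exact (Category.comp_id _).trans (fst_eq α φ h.toIsHomLift)

theorem isCocartesian_of_snd {S T : StrictPullback K U} {X Y : C} (α : X ⟶ Y) (φ : S ⟶ T)
    [h : (changeOfBase K U).IsHomLift α φ] [hc : U.IsCocartesian (K.map α) φ.snd] :
    (changeOfBase K U).IsCocartesian α φ where
  universal_property {T'} φ' hφ' := by
    obtain rfl : S.fst = X := IsHomLift.domain_eq (changeOfBase K U) α φ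
    obtain rfl : T.fst = Y := IsHomLift.codomain_eq (changeOfBase K U) α φ
    obtain ⟨Y', b', w⟩ := T'
    obtain rfl : Y' = T.fst := IsHomLift.codomain_eq (changeOfBase K U) α φ'
    have hφ : φ.fst = α := fst_eq α φ h
    have hfst : φ'.fst = α := fst_eq (T := ⟨T.fst, b', w⟩) α φ' hφ'
    have hw : U.IsHomLift (K.map α) φ'.snd := isHomLift_snd α φ'
    obtain ⟨χ, ⟨hχ, hχφ⟩, huniq⟩ := Functor.IsCocartesian.universal_property (p := U)
      (f := K.map α) (φ := φ.snd) φ'.snd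
    refine ⟨⟨𝟙 T.fst, χ, by rw [K.map_id]; exact hχ⟩, ⟨isHomLift_of_fst_eq rfl,
      hom_ext (((Category.comp_id _).trans hφ).trans hfst.symm) hχφ⟩, ?_⟩
    rintro τ ⟨hτ, hτφ⟩
    exact hom_ext (fst_eq (T := ⟨T.fst, b', w⟩) (𝟙 T.fst) τ hτ)
      (huniq τ.snd ⟨isHomLift_id_snd (X := T.fst) τ hτ, congrArg Hom.snd hτφ⟩)

/-! ### Change of base: fibres and reindexing -/

/-- The fibre of the change of base over `X` maps to the fibre of `U` over `K X`. -/
def fiberFunctor (K : C ⥤ B) (U : E ⥤ B) (X : C) :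
    (changeOfBase K U).Fiber X ⥤ U.Fiber (K.obj X) where
  obj S := ⟨S.1.snd, S.1.w.trans (congrArg K.obj S.2)⟩
  map φ := ⟨φ.1.snd, isHomLift_id_snd φ.1 φ.2⟩

/-- The first component of a vertical morphism is an identity up to equality of objects, so the
second carries all the information. -/
instance (X : C) : (fiberFunctor K U X).Faithful where
  map_injective {S T} φ ψ h := by
    obtain ⟨S, rfl⟩ := S
    obtain ⟨T, hT⟩ := T
    obtain ⟨φ, hφ⟩ := φ
    obtain ⟨ψ, hψ⟩ := ψ
    have h₁ := IsHomLift.fac' (changeOfBase K U) (𝟙 ((changeOfBase K U).obj S)) φ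
    have h₂ := IsHomLift.fac' (changeOfBase K U) (𝟙 ((changeOfBase K U).obj S)) ψ
    exact Subtype.ext (hom_ext (h₁.trans h₂.symm) (congrArg Subtype.val h))

instance (X : C) : (fiberFunctor K U X).Full where
  map_surjective {S T} β := by
    obtain ⟨⟨X, a, wa⟩, rfl⟩ := S
    obtain ⟨⟨Y, b, wb⟩, hT⟩ := T
    obtain rfl : Y = X := hT
    obtain ⟨β, hβ⟩ := β
    exact ⟨⟨⟨𝟙 Y, β, by rw [K.map_id]; exact hβ⟩, isHomLift_of_fst_eq rfl⟩, rfl⟩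

instance (X : C) : (fiberFunctor K U X).EssSurj where
  mem_essImage Q := ⟨⟨ofFiber X Q, rfl⟩, ⟨Iso.refl _⟩⟩

instance (X : C) : (fiberFunctor K U X).IsEquivalence where

end StrictPullback

/-- A morphism of a fibre, from a vertical morphism of the total category. -/
def fiberHomMk {U : E ⥤ B} {X : B} {P Q : U.Fiber X} (φ : tot P ⟶ tot Q)
    [h : U.IsHomLift (𝟙 X) φ] : P ⟶ Q :=
  ⟨φ, h⟩

@[simp]
theorem totMap_fiberHomMk {U : E ⥤ B} {X : B} {P Q : U.Fiber X} (φ : tot P ⟶ tot Q)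
    [h : U.IsHomLift (𝟙 X) φ] : totMap (fiberHomMk φ) = φ :=
  rfl

@[simp]
theorem totMap_id {U : E ⥤ B} {X : B} (P : U.Fiber X) : totMap (𝟙 P) = 𝟙 (tot P) :=
  rfl

/-- Two cartesian morphisms over `f` with the same codomain have isomorphic domains in the fibre. -/
def fiberIsoOfCartesian (U : E ⥤ B) {X Y : B} (f : X ⟶ Y) {P Q : U.Fiber X} {b : E}
    (c : tot P ⟶ b) (d : tot Q ⟶ b) (_ : U.IsCartesian f c) (_ : U.IsCartesian f d) : P ≅ Q where
  hom := fiberHomMk (Functor.IsCartesian.map U f d c)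
  inv := fiberHomMk (Functor.IsCartesian.map U f c d)
  hom_inv_id := by
    apply fiberHom_ext_of_cartesian U f c
    rw [totMap_comp, totMap_fiberHomMk, totMap_fiberHomMk, totMap_id]
    simp
  inv_hom_id := by
    apply fiberHom_ext_of_cartesian U f d
    rw [totMap_comp, totMap_fiberHomMk, totMap_fiberHomMk, totMap_id]
    simp

theorem fiberIsoOfCartesian_hom_fac (U : E ⥤ B) {X Y : B} (f : X ⟶ Y) {P Q : U.Fiber X} {b : E}
    (c : tot P ⟶ b) (d : tot Q ⟶ b) (hc : U.IsCartesian f c) (hd : U.IsCartesian f d) :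
    totMap (fiberIsoOfCartesian U f c d hc hd).hom ≫ d = c :=
  Functor.IsCartesian.fac U f d c

namespace StrictPullback

variable {C : Type u₃} [Category.{v₃} C] {K : C ⥤ B} {U : E ⥤ B}

/-- Reindexing of an object for the change of base corresponds to reindexing for `U`. -/
def reindexObjIso [U.IsFibered] [(changeOfBase K U).IsFibered] {X Y : C} (α : X ⟶ Y)
    (S : (changeOfBase K U).Fiber Y) :
    (fiberFunctor K U X).obj (reindexObj (changeOfBase K U) α S) ≅
      reindexObj U (K.map α) ((fiberFunctor K U Y).obj S) :=
  fiberIsoOfCartesian U (K.map α) (P := (fiberFunctor K U X).obj (reindexObj _ α S))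
    (Q := reindexObj U (K.map α) ((fiberFunctor K U Y).obj S))
    (cartLift (changeOfBase K U) α S).snd
    (cartLift U (K.map α) ((fiberFunctor K U Y).obj S))
    (isCartesian_snd α (cartLift (changeOfBase K U) α S)) (cartLift_isCartesian U _ _)

theorem reindexObjIso_hom_fac [U.IsFibered] [(changeOfBase K U).IsFibered] {X Y : C} (α : X ⟶ Y)
    (S : (changeOfBase K U).Fiber Y) :
    totMap (reindexObjIso α S).hom ≫ cartLift U (K.map α) ((fiberFunctor K U Y).obj S) =
      (cartLift (changeOfBase K U) α S).snd :=
  fiberIsoOfCartesian_hom_fac U (K.map α) _ _ _ _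

theorem reindexObjIso_naturality [U.IsFibered] [(changeOfBase K U).IsFibered] {X Y : C}
    (α : X ⟶ Y) {S T : (changeOfBase K U).Fiber Y} (φ : S ⟶ T) :
    (fiberFunctor K U X).map (reindexMap _ α φ) ≫ (reindexObjIso α T).hom =
      (reindexObjIso α S).hom ≫ reindexMap U (K.map α) ((fiberFunctor K U Y).map φ) := by
  apply fiberHom_ext_of_cartesian U (K.map α)
    (cartLift U (K.map α) ((fiberFunctor K U Y).obj T))
  rw [totMap_comp, totMap_comp, Category.assoc, Category.assoc, reindexMap_fac,
    reindexObjIso_hom_fac, ← Category.assoc, reindexObjIso_hom_fac]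
  exact congrArg Hom.snd (reindexMap_fac (changeOfBase K U) α φ)

/-- Reindexing for the change of base corresponds to reindexing for `U`. -/
def reindexFiberFunctorIso [U.IsFibered] [(changeOfBase K U).IsFibered] {X Y : C} (α : X ⟶ Y) :
    reindex (changeOfBase K U) α ⋙ fiberFunctor K U X ≅
      fiberFunctor K U Y ⋙ reindex U (K.map α) :=
  NatIso.ofComponents (fun S ↦ reindexObjIso α S) (fun φ ↦ reindexObjIso_naturality α φ)

/-- Reindexing for the change of base, expressed through reindexing for `U`. -/
def reindexIso [U.IsFibered] [(changeOfBase K U).IsFibered] {X Y : C} (α : X ⟶ Y) :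
    reindex (changeOfBase K U) α ≅
      (fiberFunctor K U Y ⋙ reindex U (K.map α)) ⋙ (fiberFunctor K U X).inv :=
  (Functor.rightUnitor _).symm ≪≫
    Functor.isoWhiskerLeft _ (fiberFunctor K U X).asEquivalence.unitIso ≪≫
    (Functor.associator _ _ _).symm ≪≫
    Functor.isoWhiskerRight (reindexFiberFunctorIso α) (fiberFunctor K U X).inv

/-- By `reindexIso` the functor is reindexing along `K.map α` composed with equivalences on both
sides, and equivalences are adjoints on either side. -/
theorem isRightAdjoint_reindex [U.IsFibered] [(changeOfBase K U).IsFibered] {X Y : C} (α : X ⟶ Y)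
    (h : (reindex U (K.map α)).IsRightAdjoint) :
    (reindex (changeOfBase K U) α).IsRightAdjoint :=
  Functor.isRightAdjoint_of_iso (reindexIso α).symm

theorem isLeftAdjoint_reindex [U.IsFibered] [(changeOfBase K U).IsFibered] {X Y : C} (α : X ⟶ Y)
    (h : (reindex U (K.map α)).IsLeftAdjoint) :
    (reindex (changeOfBase K U) α).IsLeftAdjoint :=
  Functor.isLeftAdjoint_of_iso (reindexIso α).symm

end StrictPullback

/-! ### Coproducts as cocartesian lifts -/

theorem exists_tot_eq (U : E ⥤ B) {X : B} {a : E} (h : U.obj a = X) :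
    ∃ P : U.Fiber X, tot P = a :=
  ⟨⟨a, h⟩, rfl⟩

theorem fiberHom_ext_of_cocartesian (U : E ⥤ B) {X Y : B} (f : X ⟶ Y) {a : E} {P R : U.Fiber Y}
    (s : a ⟶ tot P) [U.IsCocartesian f s] (φ ψ : P ⟶ R) (h : s ≫ totMap φ = s ≫ totMap ψ) :
    φ = ψ :=
  Functor.Fiber.hom_ext (Functor.IsCocartesian.ext U f s _ _ h)

theorem isIso_totMap {U : E ⥤ B} {X : B} {P Q : U.Fiber X} (t : P ⟶ Q) [IsIso t] :
    IsIso (totMap t) :=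
  Functor.map_isIso Functor.Fiber.fiberInclusion t

theorem isCocartesian_comp_of_isIso (U : E ⥤ B) {X Y : B} (f : X ⟶ Y) {a b c : E} (s : a ⟶ b)
    (t : b ⟶ c) [U.IsCocartesian f s] [U.IsHomLift (𝟙 Y) t] [IsIso t] :
    U.IsCocartesian f (s ≫ t) :=
  haveI : U.IsHomLift (𝟙 Y) (asIso t).hom := ‹_›
  Functor.IsCocartesian.of_comp_iso U f s (asIso t)

theorem isIso_of_isCocartesian_comp (U : E ⥤ B) {X Y : B} (f : X ⟶ Y) {a : E} {P Q : U.Fiber Y}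
    (s : a ⟶ tot P) (t : P ⟶ Q) [U.IsCocartesian f s] [h : U.IsCocartesian f (s ≫ totMap t)] :
    IsIso t := by
  refine ⟨fiberHomMk (Functor.IsCocartesian.map U f (s ≫ totMap t) s), ?_, ?_⟩
  · apply fiberHom_ext_of_cocartesian U f s
    rw [totMap_comp, ← Category.assoc, totMap_id, totMap_fiberHomMk, Functor.IsCocartesian.fac,
      Category.comp_id]
  · apply fiberHom_ext_of_cocartesian U f (s ≫ totMap t)
    rw [totMap_comp, ← Category.assoc, totMap_id, totMap_fiberHomMk, Functor.IsCocartesian.fac,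
      Category.comp_id]

namespace FullCartesianLawvereCategory

variable {U : E ⥤ B} (L : FullCartesianLawvereCategory U)

/-- The chosen cartesian morphism `f^* Q ⟶ Q`. -/
def pullMap {X Y : B} (f : X ⟶ Y) (Q : U.Fiber Y) : tot ((L.pull f).obj Q) ⟶ tot Q :=
  haveI := L.isFibered
  cartLift U f Q

instance pullMap_isCartesian {X Y : B} (f : X ⟶ Y) (Q : U.Fiber Y) :
    U.IsCartesian f (L.pullMap f Q) :=
  haveI := L.isFibered
  cartLift_isCartesian U f Q

theorem pull_map_fac {X Y : B} (f : X ⟶ Y) {P Q : U.Fiber Y} (φ : P ⟶ Q) :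
    totMap ((L.pull f).map φ) ≫ L.pullMap f Q = L.pullMap f P ≫ totMap φ :=
  haveI := L.isFibered
  reindexMap_fac U f φ

/-- The unit `P ⟶ f^* Σ_f P`. -/
def sigmaUnit {X Y : B} (f : X ⟶ Y) (P : U.Fiber X) : P ⟶ (L.pull f).obj ((L.sigma f).obj P) :=
  (L.sigmaAdj f).unit.app P

theorem sigmaMap_eq {X Y : B} (f : X ⟶ Y) (P : U.Fiber X) :
    L.sigmaMap f P = totMap (L.sigmaUnit f P) ≫ L.pullMap f ((L.sigma f).obj P) :=
  rfl

theorem sigmaMap_isHomLift {X Y : B} (f : X ⟶ Y) (P : U.Fiber X) :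
    U.IsHomLift f (L.sigmaMap f P) := by
  rw [sigmaMap_eq]
  exact IsHomLift.comp_lift_id_left U f (L.pullMap f ((L.sigma f).obj P))
    (totMap (L.sigmaUnit f P))

theorem totMap_homEquiv_comp_pullMap {X Y : B} (f : X ⟶ Y) {P : U.Fiber X} {Q : U.Fiber Y}
    (χ : (L.sigma f).obj P ⟶ Q) :
    totMap ((L.sigmaAdj f).homEquiv P Q χ) ≫ L.pullMap f Q = L.sigmaMap f P ≫ totMap χ := by
  have h : (L.sigmaAdj f).homEquiv P Q χ = L.sigmaUnit f P ≫ (L.pull f).map χ :=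
    Adjunction.homEquiv_unit _ _ _ _
  rw [h, totMap_comp, Category.assoc, pull_map_fac, sigmaMap_eq, Category.assoc]

/-- Maps `P ⟶ Q` over `f` correspond to vertical maps `P ⟶ f^* Q` by cartesianness, hence to
vertical maps `Σ_f P ⟶ Q` by adjunction. -/
instance sigmaMap_isCocartesian {X Y : B} (f : X ⟶ Y) (P : U.Fiber X) :
    U.IsCocartesian f (L.sigmaMap f P) := by
  have hl := L.sigmaMap_isHomLift f P
  refine ⟨?_⟩
  intro b' φ' hφ'
  obtain ⟨Q, rfl⟩ := exists_tot_eq U (IsHomLift.codomain_eq U f φ')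
  let τ : P ⟶ (L.pull f).obj Q := fiberHomMk (Functor.IsCartesian.map U f (L.pullMap f Q) φ')
  have hτ : totMap τ ≫ L.pullMap f Q = φ' := Functor.IsCartesian.fac U f (L.pullMap f Q) φ'
  refine ⟨totMap (((L.sigmaAdj f).homEquiv P Q).symm τ), ⟨inferInstance, ?_⟩, ?_⟩
  · rw [← L.totMap_homEquiv_comp_pullMap, Equiv.apply_symm_apply, hτ]
  · rintro ψ ⟨hψ, hψφ⟩
    suffices fiberHomMk ψ = ((L.sigmaAdj f).homEquiv P Q).symm τ from congrArg totMap this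
    rw [Equiv.eq_symm_apply]
    apply fiberHom_ext_of_cartesian U f (L.pullMap f Q)
    rw [hτ, L.totMap_homEquiv_comp_pullMap, totMap_fiberHomMk, hψφ]

/-! ### Beck–Chevalley and very strong coproducts, independently of chosen lifts -/

/-- The components of the Beck-Chevalley transformation. -/
def beckChevalleyApp {W X Y Z : B} {i : W ⟶ X} {j : W ⟶ Y} {f : X ⟶ Z}
    {g : Y ⟶ Z} (h : i ≫ f = j ≫ g) (P : U.Fiber X) :
    (L.sigma j).obj ((L.pull i).obj P) ⟶ (L.pull g).obj ((L.sigma f).obj P) :=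
  (L.beckChevalleyMap h).app P

/-- The canonical comparison `i^* f^* P ⟶ j^* g^* P` for a commutative square. -/
def pullSquareApp {W X Y Z : B} {i : W ⟶ X} {j : W ⟶ Y} {f : X ⟶ Z}
    {g : Y ⟶ Z} (h : i ≫ f = j ≫ g) (P : U.Fiber Z) :
    (L.pull i).obj ((L.pull f).obj P) ⟶ (L.pull j).obj ((L.pull g).obj P) :=
  haveI := L.isFibered
  reindexSquareApp U h P

theorem pullSquareApp_fac {W X Y Z : B} {i : W ⟶ X} {j : W ⟶ Y} {f : X ⟶ Z}
    {g : Y ⟶ Z} (h : i ≫ f = j ≫ g) (P : U.Fiber Z) :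
    totMap (L.pullSquareApp h P) ≫ L.pullMap j ((L.pull g).obj P) ≫ L.pullMap g P =
      L.pullMap i ((L.pull f).obj P) ≫ L.pullMap f P :=
  haveI := L.isFibered
  reindexSquareApp_fac U h P

theorem homEquiv_beckChevalleyApp {W X Y Z : B} {i : W ⟶ X} {j : W ⟶ Y} {f : X ⟶ Z}
    {g : Y ⟶ Z} (h : i ≫ f = j ≫ g) (P : U.Fiber X) :
    (L.sigmaAdj j).homEquiv _ _ (L.beckChevalleyApp h P) =
      (L.pull i).map (L.sigmaUnit f P) ≫ L.pullSquareApp h ((L.sigma f).obj P) := by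
  have := L.isFibered
  rw [Adjunction.homEquiv_unit]
  exact (unit_mateEquiv_symm (L.sigmaAdj f) (L.sigmaAdj j)
    (TwoSquare.mk _ _ _ _ (reindexSquare U h)) P).symm

/-- This square determines the Beck–Chevalley component, as its left edge is cocartesian and its
right edge cartesian; it frees later arguments from the mate calculus. -/
theorem sigmaMap_comp_beckChevalleyApp {W X Y Z : B} {i : W ⟶ X} {j : W ⟶ Y} {f : X ⟶ Z}
    {g : Y ⟶ Z} (h : i ≫ f = j ≫ g) (P : U.Fiber X) :
    (L.sigmaMap j ((L.pull i).obj P) ≫ totMap (L.beckChevalleyApp h P)) ≫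
      L.pullMap g ((L.sigma f).obj P) = L.pullMap i P ≫ L.sigmaMap f P := by
  rw [← totMap_homEquiv_comp_pullMap, homEquiv_beckChevalleyApp, totMap_comp, Category.assoc,
    Category.assoc, pullSquareApp_fac, ← Category.assoc, pull_map_fac, Category.assoc,
    sigmaMap_eq]

/-- The Beck-Chevalley condition in terms of (co)cartesian morphisms: the pullback of a
cocartesian morphism along cartesian morphisms is cocartesian. -/
theorem BeckChevalley.isCocartesian {L : FullCartesianLawvereCategory U} (hBC : L.BeckChevalley)
    {W X Y Z : B} {i : W ⟶ X} {j : W ⟶ Y} {f : X ⟶ Z} {g : Y ⟶ Z} (h : IsPullback i j f g)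
    {P' P Q' Q : E} (c : P' ⟶ P) (t : P' ⟶ Q') (s : P ⟶ Q) (d : Q' ⟶ Q) (w : c ≫ s = t ≫ d)
    [hc : U.IsCartesian i c] [hs : U.IsCocartesian f s] [hd : U.IsCartesian g d]
    [ht : U.IsHomLift j t] : U.IsCocartesian j t := by
  have := L.isFibered
  obtain ⟨P, rfl⟩ := exists_tot_eq U (IsHomLift.codomain_eq U i c)
  have hiso : IsIso (L.beckChevalleyMap h.w) := hBC h
  let k : Q ≅ tot ((L.sigma f).obj P) :=
    Functor.IsCocartesian.codomainUniqueUpToIso U f s (L.sigmaMap f P)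
  have hk : U.IsHomLift (𝟙 Z) k.hom := Functor.IsCocartesian.map_isHomLift U f s _
  have hsk : s ≫ k.hom = L.sigmaMap f P := Functor.IsCocartesian.fac U f s _
  have hdk : U.IsCartesian g (d ≫ k.hom) := inferInstance
  let e : Q' ≅ tot ((L.pull g).obj ((L.sigma f).obj P)) :=
    Functor.IsCartesian.domainUniqueUpToIso U g (L.pullMap g ((L.sigma f).obj P)) (d ≫ k.hom)
  have he : U.IsHomLift (𝟙 Y) e.hom := Functor.IsCartesian.map_isHomLift U g _ _
  have hed : e.hom ≫ L.pullMap g ((L.sigma f).obj P) = d ≫ k.hom :=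
    Functor.IsCartesian.fac U g _ _
  let e' : P' ≅ tot ((L.pull i).obj P) :=
    Functor.IsCartesian.domainUniqueUpToIso U i (L.pullMap i P) c
  have he' : U.IsHomLift (𝟙 W) e'.hom := Functor.IsCartesian.map_isHomLift U i _ _
  have hec : e'.hom ≫ L.pullMap i P = c := Functor.IsCartesian.fac U i _ _
  let r := L.sigmaMap j ((L.pull i).obj P) ≫ totMap (L.beckChevalleyApp h.w P)
  have hb : IsIso (L.beckChevalleyApp h.w P) := NatIso.isIso_app_of_isIso (L.beckChevalleyMap h.w) P
  have hb' := isIso_totMap (L.beckChevalleyApp h.w P)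
  have hr : U.IsCocartesian j r :=
    isCocartesian_comp_of_isIso U j (L.sigmaMap j ((L.pull i).obj P)) _
  have hr' : r ≫ L.pullMap g ((L.sigma f).obj P) = L.pullMap i P ≫ L.sigmaMap f P :=
    L.sigmaMap_comp_beckChevalleyApp h.w P
  -- After comparison with the chosen lifts, `t` and `r` fill the same square, and the cartesian
  -- edge over `g` allows one filler over `j`. The maps tested are not vertical, so strong
  -- cartesianness is needed.
  have ht : t = (e'.hom ≫ r) ≫ e.inv := by
    rw [Iso.eq_comp_inv]
    have : U.IsHomLift j (e'.hom ≫ r) := inferInstance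
    have : U.IsHomLift j (t ≫ e.hom) := inferInstance
    apply Functor.IsStronglyCartesian.ext U g (L.pullMap g ((L.sigma f).obj P)) j
    rw [Category.assoc, hed, ← Category.assoc, ← w, Category.assoc, hsk, Category.assoc, hr',
      ← Category.assoc, hec]
  rw [ht]
  exact isCocartesian_comp_of_isIso U j (e'.hom ≫ r) e.inv

/-- Applied to the chosen lifts, the hypothesis makes the Beck–Chevalley component a vertical
comparison between two cocartesian morphisms with the same domain, hence invertible. -/
theorem beckChevalley_of_isCocartesian
    (H : ∀ ⦃W X Y Z : B⦄ ⦃i : W ⟶ X⦄ ⦃j : W ⟶ Y⦄ ⦃f : X ⟶ Z⦄ ⦃g : Y ⟶ Z⦄, IsPullback i j f g →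
      ∀ ⦃P' P Q' Q : E⦄ (c : P' ⟶ P) (t : P' ⟶ Q') (s : P ⟶ Q) (d : Q' ⟶ Q), c ≫ s = t ≫ d →
      U.IsCartesian i c → U.IsCocartesian f s → U.IsCartesian g d → U.IsHomLift j t →
      U.IsCocartesian j t) : L.BeckChevalley := by
  intro W X Y Z i j f g h
  have happ : ∀ P, IsIso ((L.beckChevalleyMap h.w).app P) := by
    intro P
    have hl : U.IsHomLift j (L.sigmaMap j ((L.pull i).obj P) ≫
      totMap (L.beckChevalleyApp h.w P)) := IsHomLift.comp_lift_id_right U j _ _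
    have := H h (L.pullMap i P) _ (L.sigmaMap f P) (L.pullMap g ((L.sigma f).obj P))
      (L.sigmaMap_comp_beckChevalleyApp h.w P).symm inferInstance inferInstance inferInstance hl
    exact isIso_of_isCocartesian_comp U j (L.sigmaMap j ((L.pull i).obj P))
      (L.beckChevalleyApp h.w P)
  exact NatIso.isIso_of_isIso_app _

theorem VeryStrongCoproducts.isIso_map {L : FullCartesianLawvereCategory U}
    (h : L.VeryStrongCoproducts) {X Y : B} (f : X ⟶ Y) {P Q : E} (s : P ⟶ Q)
    [hs : U.IsCocartesian f s] : IsIso (L.compr.map s) := by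
  obtain ⟨P, rfl⟩ := exists_tot_eq U (IsHomLift.domain_eq U f s)
  let k : tot ((L.sigma f).obj P) ≅ Q :=
    Functor.IsCocartesian.codomainUniqueUpToIso U f (L.sigmaMap f P) s
  have hk : L.sigmaMap f P ≫ k.hom = s := Functor.IsCocartesian.fac U f _ s
  have := h f P
  rw [← hk, Functor.map_comp]
  infer_instance

/-! ### Pullbacks in the fibres and their comprehensions -/

theorem exists_isHomLift {T A : B} {R : U.Fiber T} {X : U.Fiber A} (x : tot R ⟶ tot X) :
    ∃ u : T ⟶ A, U.IsHomLift u x := by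
  obtain ⟨R, rfl⟩ := R
  obtain ⟨X, rfl⟩ := X
  exact ⟨U.map x, IsHomLift.map U x⟩

theorem isHomLift_of_comp_totMap {T A : B} {R : U.Fiber T} {X Y : U.Fiber A} (x : tot R ⟶ tot X) (f : X ⟶ Y)
    (u : T ⟶ A) [U.IsHomLift u (x ≫ totMap f)] : U.IsHomLift u x := by
  obtain ⟨v, hv⟩ := exists_isHomLift x
  have : U.IsHomLift v (x ≫ totMap f) := IsHomLift.comp_lift_id_right U v x (totMap f)
  rwa [isHomLift_unique U u v (x ≫ totMap f)]

/-- Pullbacks in a fibre are pullbacks in the total category. -/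
theorem isPullback_totMap (L : FullCartesianLawvereCategory U) {A : B} {W X Y Z : U.Fiber A} {i : W ⟶ X} {j : W ⟶ Y} {f : X ⟶ Z}
    {g : Y ⟶ Z} (h : IsPullback i j f g) :
    IsPullback (totMap i) (totMap j) (totMap f) (totMap g) := by
  have key : ∀ {T : B} (R : U.Fiber T) (x : tot R ⟶ tot X) (y : tot R ⟶ tot Y), x ≫ totMap f = y ≫ totMap g →
      ∃! m : tot R ⟶ tot W, m ≫ totMap i = x ∧ m ≫ totMap j = y := by
    intro T R x y hxy
    obtain ⟨u, hx⟩ := exists_isHomLift x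
    have hy : U.IsHomLift u y := by
      have : U.IsHomLift u (y ≫ totMap g) := hxy ▸ IsHomLift.comp_lift_id_right U u x (totMap f)
      exact isHomLift_of_comp_totMap y g u
    -- Both legs lie over the same `u`, so they factor through `R ⟶ Σ_u R`, turning a cone in `E`
    -- into one in the fibre over `A`.
    let x' : (L.sigma u).obj R ⟶ X := fiberHomMk (Functor.IsCocartesian.map U u (L.sigmaMap u R) x)
    let y' : (L.sigma u).obj R ⟶ Y := fiberHomMk (Functor.IsCocartesian.map U u (L.sigmaMap u R) y)
    have hx' : L.sigmaMap u R ≫ totMap x' = x := Functor.IsCocartesian.fac U u (L.sigmaMap u R) x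
    have hy' : L.sigmaMap u R ≫ totMap y' = y := Functor.IsCocartesian.fac U u (L.sigmaMap u R) y
    have hw : x' ≫ f = y' ≫ g := by
      apply fiberHom_ext_of_cocartesian U u (L.sigmaMap u R)
      rw [totMap_comp, totMap_comp, ← Category.assoc, hx', ← Category.assoc, hy', hxy]
    refine ⟨L.sigmaMap u R ≫ totMap (h.lift x' y' hw), ⟨?_, ?_⟩, ?_⟩
    · rw [Category.assoc, ← totMap_comp, h.lift_fst, hx']
    · rw [Category.assoc, ← totMap_comp, h.lift_snd, hy']
    · rintro m ⟨hm₁, hm₂⟩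
      have : U.IsHomLift u (m ≫ totMap i) := hm₁ ▸ hx
      have hm : U.IsHomLift u m := isHomLift_of_comp_totMap m i u
      let m' : (L.sigma u).obj R ⟶ W :=
        fiberHomMk (Functor.IsCocartesian.map U u (L.sigmaMap u R) m)
      have hm' : L.sigmaMap u R ≫ totMap m' = m := Functor.IsCocartesian.fac U u (L.sigmaMap u R) m
      rw [← hm']
      congr 2
      apply h.hom_ext
      · rw [h.lift_fst]
        apply fiberHom_ext_of_cocartesian U u (L.sigmaMap u R)
        rw [totMap_comp, ← Category.assoc, hm', hm₁, hx']
      · rw [h.lift_snd]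
        apply fiberHom_ext_of_cocartesian U u (L.sigmaMap u R)
        rw [totMap_comp, ← Category.assoc, hm', hm₂, hy']
  have hsq : totMap i ≫ totMap f = totMap j ≫ totMap g := by
    rw [← totMap_comp, h.w, totMap_comp]
  refine ⟨⟨hsq⟩, ⟨Limits.PullbackCone.IsLimit.mk hsq
    (fun s ↦ (key ⟨s.pt, rfl⟩ s.fst s.snd s.condition).choose)
    (fun s ↦ (key ⟨s.pt, rfl⟩ s.fst s.snd s.condition).choose_spec.1.1)
    (fun s ↦ (key ⟨s.pt, rfl⟩ s.fst s.snd s.condition).choose_spec.1.2)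
    (fun s m h₁ h₂ ↦ (key ⟨s.pt, rfl⟩ s.fst s.snd s.condition).choose_spec.2 m ⟨h₁, h₂⟩)⟩⟩

/-- The inclusion of the fibre preserves pullbacks because of the coproducts, and `{-}` on `E`
preserves them as a right adjoint. -/
theorem isPullback_fiberCompr {A : B} {W X Y Z : U.Fiber A} {i : W ⟶ X} {j : W ⟶ Y} {f : X ⟶ Z}
    {g : Y ⟶ Z} (h : IsPullback i j f g) :
    IsPullback ((L.fiberCompr A).map i) ((L.fiberCompr A).map j) ((L.fiberCompr A).map f)
      ((L.fiberCompr A).map g) :=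
  haveI : Limits.PreservesLimitsOfSize.{0, 0} L.compr := L.comprAdj.rightAdjoint_preservesLimits
  (L.isPullback_totMap h).map L.compr

end FullCartesianLawvereCategory

/-! ### Truth and comprehension in terms of lifts -/

namespace ComprehensionCategoryWithUnit

variable {U : E ⥤ B} (L : ComprehensionCategoryWithUnit U)

theorem truth_obj (X : B) : U.obj (L.truth.obj X) = X :=
  Functor.congr_obj L.truth_comp X

instance truth_map_isHomLift {X Y : B} (f : X ⟶ Y) : U.IsHomLift f (L.truth.map f) := by
  refine IsHomLift.of_fac' U f (L.truth.map f) (L.truth_obj X) (L.truth_obj Y) ?_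
  exact Functor.congr_hom L.truth_comp f

/-- Since the counit of `U ⊣ ⊤` is an identity, transposition is just `U`; thus maps into truth are
determined by what they lie over. -/
theorem map_comp_counit {Q : E} {Y : B} (φ : Q ⟶ L.truth.obj Y) :
    (L.truthAdj.homEquiv Q Y).symm φ = U.map φ ≫ eqToHom (L.truth_obj Y) := by
  rw [Adjunction.homEquiv_counit, L.truthAdj_counit, eqToHom_app]

theorem truth_hom_ext {Q : E} {X Y : B} (f : X ⟶ Y) (φ ψ : Q ⟶ L.truth.obj Y)
    [U.IsHomLift f φ] [U.IsHomLift f ψ] : φ = ψ := by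
  apply (L.truthAdj.homEquiv Q Y).symm.injective
  rw [map_comp_counit, map_comp_counit, IsHomLift.fac' U f φ, IsHomLift.fac' U f ψ]

theorem exists_truth_lift {Q : E} {X Y : B} (hQ : U.obj Q = X) (f : X ⟶ Y) :
    ∃ φ : Q ⟶ L.truth.obj Y, U.IsHomLift f φ := by
  refine ⟨L.truthAdj.homEquiv Q Y (eqToHom hQ ≫ f), ?_⟩
  refine IsHomLift.of_commsq U f _ hQ (L.truth_obj Y) ?_
  rw [← map_comp_counit, Equiv.symm_apply_apply]

/-- The projection `{P} ⟶ X` of an object `P` over `X`. -/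
def projTo (P : E) {X : B} (h : U.obj P = X) : L.compr.obj P ⟶ X :=
  L.proj.app P ≫ eqToHom h

theorem compr_map_projTo {P Q : E} {X Y : B} (hP : U.obj P = X) (hQ : U.obj Q = Y) (f : X ⟶ Y)
    (φ : P ⟶ Q) [h : U.IsHomLift f φ] :
    L.compr.map φ ≫ L.projTo Q hQ = L.projTo P hP ≫ f := by
  subst hP hQ
  obtain rfl := IsHomLift.eq_of_isHomLift U f φ
  simp [projTo]

theorem counit_isHomLift {Q : E} {Y : B} (hQ : U.obj Q = Y) :
    U.IsHomLift (L.projTo Q hQ) (L.comprAdj.counit.app Q) := by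
  subst hQ
  refine IsHomLift.of_fac U _ _ (L.truth_obj _) rfl ?_
  simp [projTo, proj]

theorem homEquiv_symm_isHomLift {X Y : B} {Q : E} (hQ : U.obj Q = Y) (b : X ⟶ L.compr.obj Q) :
    U.IsHomLift (b ≫ L.projTo Q hQ) ((L.comprAdj.homEquiv X Q).symm b) := by
  rw [Adjunction.homEquiv_counit]
  have := L.counit_isHomLift hQ
  exact IsHomLift.comp U b (L.projTo Q hQ) (L.truth.map b) (L.comprAdj.counit.app Q)

/-- The map `β` factors through the counit, which lies over the projection, and a morphism lies over
only one base map between given objects. -/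
theorem homEquiv_projTo {X Y : B} {Q : E} (hQ : U.obj Q = Y) (u : X ⟶ Y)
    (β : L.truth.obj X ⟶ Q) [U.IsHomLift u β] :
    L.comprAdj.homEquiv X Q β ≫ L.projTo Q hQ = u := by
  have := L.homEquiv_symm_isHomLift hQ (L.comprAdj.homEquiv X Q β)
  rw [Equiv.symm_apply_apply] at this
  exact isHomLift_unique U _ _ β

variable {L}

theorem IsFull.exists_lift (hL : L.IsFull) {P Q : E} {X Y : B} (hP : U.obj P = X)
    (hQ : U.obj Q = Y) (f : X ⟶ Y) (b : L.compr.obj P ⟶ L.compr.obj Q)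
    (hb : b ≫ L.projTo Q hQ = L.projTo P hP ≫ f) :
    ∃ φ : P ⟶ Q, U.IsHomLift f φ ∧ L.compr.map φ = b := by
  subst hP hQ
  have := hL.1
  have hb' : b ≫ L.proj.app Q = L.proj.app P ≫ f := by simpa [projTo] using hb
  obtain ⟨φ, hφ⟩ := L.toArrow.map_surjective (X := P) (Y := Q) (Arrow.homMk b f hb')
  obtain rfl : U.map φ = f := congrArg (fun t ↦ t.right) hφ
  exact ⟨φ, inferInstance, congrArg (fun t ↦ t.left) hφ⟩

theorem IsFull.hom_ext (hL : L.IsFull) {P Q : E} {X Y : B} (f : X ⟶ Y) (φ ψ : P ⟶ Q)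
    [U.IsHomLift f φ] [U.IsHomLift f ψ] (h : L.compr.map φ = L.compr.map ψ) : φ = ψ := by
  have := hL.2
  apply L.toArrow.map_injective
  have hU : U.map φ = U.map ψ := by rw [IsHomLift.fac' U f φ, IsHomLift.fac' U f ψ]
  exact Arrow.hom_ext _ _ h hU

end ComprehensionCategoryWithUnit

/-! ### Comprehension for a change of base -/

/-- Data exhibiting `K : C ⥤ B` as a full subcategory of the slice over `A` which is closed under
composition with the projections of the comprehension category `L`. -/
structure SumClosed {U : E ⥤ B} (L : ComprehensionCategoryWithUnit U) {C : Type u₃}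
    [Category.{v₃} C] (K : C ⥤ B) (A : B) where
  /-- the structure morphism to `A` -/
  toBase (P : C) : K.obj P ⟶ A
  map_toBase {P Q : C} (α : P ⟶ Q) : K.map α ≫ toBase Q = toBase P
  exists_map {P Q : C} (b : K.obj P ⟶ K.obj Q) (h : b ≫ toBase Q = toBase P) :
    ∃ α : P ⟶ Q, K.map α = b
  map_inj {P Q : C} {α β : P ⟶ Q} (h : K.map α = K.map β) : α = β
  /-- the sum of a family -/
  sum (S : StrictPullback K U) : C
  /-- the comprehension of the sum -/
  sumIso (S : StrictPullback K U) : L.compr.obj S.snd ≅ K.obj (sum S)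
  sumIso_toBase (S : StrictPullback K U) :
    (sumIso S).hom ≫ toBase (sum S) = L.projTo S.snd S.w ≫ toBase S.fst

namespace SumClosed

variable {U : E ⥤ B} {L : ComprehensionCategoryWithUnit U} {C : Type u₃} [Category.{v₃} C]
  {K : C ⥤ B} {A : B} (D : SumClosed L K A)

/-- The morphism of `C` corresponding to a morphism over `A`. -/
def preimage {P Q : C} (b : K.obj P ⟶ K.obj Q) (h : b ≫ D.toBase Q = D.toBase P) : P ⟶ Q :=
  (D.exists_map b h).choose

@[simp]
theorem map_preimage {P Q : C} (b : K.obj P ⟶ K.obj Q) (h : b ≫ D.toBase Q = D.toBase P) :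
    K.map (D.preimage b h) = b :=
  (D.exists_map b h).choose_spec

/-- The inverse of a map over `A` is again over `A`, so it lifts to `C`. -/
theorem isIso_of_map (D : SumClosed L K A) {P Q : C} (α : P ⟶ Q) [IsIso (K.map α)] : IsIso α := by
  refine ⟨D.preimage (inv (K.map α)) ?_, ?_, ?_⟩
  · rw [IsIso.inv_comp_eq, D.map_toBase]
  · exact D.map_inj (by simp)
  · exact D.map_inj (by simp)

/-- The truth functor of the change of base. -/
def truth (L : ComprehensionCategoryWithUnit U) (K : C ⥤ B) : C ⥤ StrictPullback K U where
  obj P := ⟨P, L.truth.obj (K.obj P), L.truth_obj _⟩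
  map α := ⟨α, L.truth.map (K.map α), L.truth_map_isHomLift _⟩
  map_id P := StrictPullback.hom_ext rfl (by
    change L.truth.map (K.map (𝟙 P)) = 𝟙 _
    simp)
  map_comp α β := StrictPullback.hom_ext rfl (by
    change L.truth.map (K.map (α ≫ β)) = L.truth.map (K.map α) ≫ L.truth.map (K.map β)
    simp)

/-- The unit of the adjunction between the change of base and its truth functor. -/
def truthUnit (L : ComprehensionCategoryWithUnit U) (K : C ⥤ B) (S : StrictPullback K U) :
    S ⟶ (truth L K).obj S.fst :=
  ⟨𝟙 S.fst, (L.exists_truth_lift S.w (K.map (𝟙 S.fst))).choose,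
    (L.exists_truth_lift S.w (K.map (𝟙 S.fst))).choose_spec⟩

theorem hom_truth_ext {S : StrictPullback K U} {P : C} {φ ψ : S ⟶ (truth L K).obj P}
    (h : φ.fst = ψ.fst) : φ = ψ := by
  refine StrictPullback.hom_ext h ?_
  have h₂ : U.IsHomLift (K.map φ.fst) ψ.snd := by rw [h]; exact ψ.w
  exact @ComprehensionCategoryWithUnit.truth_hom_ext _ _ _ _ _ L _ _ _ (K.map φ.fst)
    φ.snd ψ.snd φ.w h₂

/-- The truth functor of the change of base is right adjoint to the change of base. -/
def truthAdj (L : ComprehensionCategoryWithUnit U) (K : C ⥤ B) :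
    changeOfBase K U ⊣ truth L K where
  unit :=
    { app S := truthUnit L K S
      naturality _ _ φ := hom_truth_ext
        ((Category.comp_id φ.fst).trans (Category.id_comp φ.fst).symm) }
  counit := 𝟙 (𝟭 C)
  left_triangle_components S := Category.comp_id (𝟙 S.fst)
  right_triangle_components P := hom_truth_ext (Category.comp_id (𝟙 P))

/-- A morphism from truth to a family, from its components. -/
def truthHomMk {P : C} {S : StrictPullback K U} (α : P ⟶ S.fst)
    (β : L.truth.obj (K.obj P) ⟶ S.snd) (h : U.IsHomLift (K.map α) β) : (truth L K).obj P ⟶ S :=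
  ⟨α, β, h⟩

/-- The first component of a morphism from truth to a family. -/
def truthHomFst {P : C} {S : StrictPullback K U} (g : (truth L K).obj P ⟶ S) : P ⟶ S.fst :=
  g.fst

/-- The second component of a morphism from truth to a family. -/
def truthHomSnd {P : C} {S : StrictPullback K U} (g : (truth L K).obj P ⟶ S) :
    L.truth.obj (K.obj P) ⟶ S.snd :=
  g.snd

theorem truthHom_isHomLift {P : C} {S : StrictPullback K U} (g : (truth L K).obj P ⟶ S) :
    U.IsHomLift (K.map (truthHomFst g)) (truthHomSnd g) :=
  g.w

theorem truthHom_ext {P : C} {S : StrictPullback K U} {g h : (truth L K).obj P ⟶ S}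
    (h₁ : truthHomFst g = truthHomFst h) (h₂ : truthHomSnd g = truthHomSnd h) : g = h :=
  StrictPullback.hom_ext h₁ h₂

@[simp]
theorem truthHomFst_mk {P : C} {S : StrictPullback K U} (α : P ⟶ S.fst)
    (β : L.truth.obj (K.obj P) ⟶ S.snd) (h : U.IsHomLift (K.map α) β) :
    truthHomFst (truthHomMk α β h) = α :=
  rfl

@[simp]
theorem truthHomSnd_mk {P : C} {S : StrictPullback K U} (α : P ⟶ S.fst)
    (β : L.truth.obj (K.obj P) ⟶ S.snd) (h : U.IsHomLift (K.map α) β) :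
    truthHomSnd (truthHomMk α β h) = β :=
  rfl

theorem truthHomSnd_map_comp {P Q : C} {S : StrictPullback K U} (α : P ⟶ Q)
    (g : (truth L K).obj Q ⟶ S) :
    truthHomSnd ((truth L K).map α ≫ g) = L.truth.map (K.map α) ≫ truthHomSnd g :=
  rfl

theorem truthHomSnd_comp {P : C} {S T : StrictPullback K U} (g : (truth L K).obj P ⟶ S)
    (φ : S ⟶ T) : truthHomSnd (g ≫ φ) = truthHomSnd g ≫ φ.snd :=
  rfl

theorem homEquiv_truthHomSnd_projTo {P : C} {S : StrictPullback K U}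
    (g : (truth L K).obj P ⟶ S) :
    L.comprAdj.homEquiv (K.obj P) S.snd (truthHomSnd g) ≫ L.projTo S.snd S.w =
      K.map (truthHomFst g) :=
  haveI := truthHom_isHomLift g
  L.homEquiv_projTo S.w (K.map (truthHomFst g)) (truthHomSnd g)

theorem homEquiv_truthHomSnd_toBase {P : C} {S : StrictPullback K U}
    (g : (truth L K).obj P ⟶ S) :
    (L.comprAdj.homEquiv (K.obj P) S.snd (truthHomSnd g) ≫ (D.sumIso S).hom) ≫
      D.toBase (D.sum S) = D.toBase P := by
  rw [Category.assoc, D.sumIso_toBase, ← Category.assoc, homEquiv_truthHomSnd_projTo,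
    D.map_toBase]

theorem map_sumIso_inv_toBase {P : C} {S : StrictPullback K U} (c : P ⟶ D.sum S) :
    (K.map c ≫ (D.sumIso S).inv ≫ L.projTo S.snd S.w) ≫ D.toBase S.fst = D.toBase P := by
  rw [Category.assoc, Category.assoc, ← D.sumIso_toBase, Iso.inv_hom_id_assoc, D.map_toBase]

/-- A morphism from truth to a family corresponds to a morphism to its sum. -/
def homEquiv (P : C) (S : StrictPullback K U) : ((truth L K).obj P ⟶ S) ≃ (P ⟶ D.sum S) where
  toFun g := D.preimage
    (L.comprAdj.homEquiv (K.obj P) S.snd (truthHomSnd g) ≫ (D.sumIso S).hom)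
    (D.homEquiv_truthHomSnd_toBase g)
  invFun c := truthHomMk
    -- This choice is forced: the image under `K` of the first component must be what the second
    -- component lies over.
    (D.preimage (K.map c ≫ (D.sumIso S).inv ≫ L.projTo S.snd S.w)
      (D.map_sumIso_inv_toBase c))
    ((L.comprAdj.homEquiv (K.obj P) S.snd).symm (K.map c ≫ (D.sumIso S).inv)) (by
      rw [map_preimage, ← Category.assoc]
      exact L.homEquiv_symm_isHomLift S.w _)
  left_inv g := by
    refine truthHom_ext (D.map_inj ?_) ?_
    · rw [truthHomFst_mk, map_preimage, map_preimage, Category.assoc, Iso.hom_inv_id_assoc,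
        homEquiv_truthHomSnd_projTo]
    · rw [truthHomSnd_mk, map_preimage, Category.assoc, Iso.hom_inv_id, Category.comp_id,
        Equiv.symm_apply_apply]
  right_inv c := D.map_inj (by simp)

theorem map_homEquiv {P : C} {S : StrictPullback K U} (g : (truth L K).obj P ⟶ S) :
    K.map (D.homEquiv P S g) =
      L.comprAdj.homEquiv (K.obj P) S.snd (truthHomSnd g) ≫ (D.sumIso S).hom :=
  D.map_preimage _ (D.homEquiv_truthHomSnd_toBase g)

theorem homEquiv_symm_snd {P : C} {S : StrictPullback K U} (c : P ⟶ D.sum S) :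
    truthHomSnd ((D.homEquiv P S).symm c) =
      (L.comprAdj.homEquiv (K.obj P) S.snd).symm (K.map c ≫ (D.sumIso S).inv) :=
  rfl

theorem map_homEquiv_symm_fst {P : C} {S : StrictPullback K U} (c : P ⟶ D.sum S) :
    K.map (truthHomFst ((D.homEquiv P S).symm c)) =
      K.map c ≫ (D.sumIso S).inv ≫ L.projTo S.snd S.w :=
  D.map_preimage _ (D.map_sumIso_inv_toBase c)

theorem homEquiv_naturality {P Q : C} {S : StrictPullback K U} (α : P ⟶ Q)
    (g : (truth L K).obj Q ⟶ S) :
    D.homEquiv P S ((truth L K).map α ≫ g) = α ≫ D.homEquiv Q S g := by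
  apply D.map_inj
  rw [map_homEquiv, K.map_comp, map_homEquiv, ← Category.assoc,
    ← Adjunction.homEquiv_naturality_left, truthHomSnd_map_comp]

/-- The structure of a comprehension category with unit on a change of base. -/
def comprehension (D : SumClosed L K A) :
    ComprehensionCategoryWithUnit (changeOfBase K U) where
  isFibered :=
    haveI := L.isFibered
    StrictPullback.changeOfBase_isFibered
  truth := truth L K
  truth_comp := rfl
  truthAdj := truthAdj L K
  truthAdj_counit := rfl
  compr := Adjunction.rightAdjointOfEquiv D.homEquiv fun _ _ _ α g ↦ D.homEquiv_naturality α g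
  comprAdj := Adjunction.adjunctionOfEquivRight D.homEquiv
    fun _ _ _ α g ↦ D.homEquiv_naturality α g

/-- The action of the comprehension functor of the change of base. -/
def comprMap {S T : StrictPullback K U} (φ : S ⟶ T) : D.sum S ⟶ D.sum T :=
  D.comprehension.compr.map φ

/-- The projection of the comprehension category structure on the change of base. -/
def projApp (S : StrictPullback K U) : D.sum S ⟶ S.fst :=
  D.comprehension.proj.app S

theorem comprMap_eq {S T : StrictPullback K U} (φ : S ⟶ T) :
    D.comprMap φ = D.homEquiv (D.sum S) T ((D.homEquiv (D.sum S) S).symm (𝟙 (D.sum S)) ≫ φ) :=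
  rfl

theorem projApp_eq (S : StrictPullback K U) :
    D.projApp S = truthHomFst ((D.homEquiv (D.sum S) S).symm (𝟙 (D.sum S))) :=
  Category.id_comp _

/-- Up to `sumIso`, the new comprehension is the old one on second components; fullness and
invertibility questions thereby reduce to `L`. -/
theorem map_comprMap {S T : StrictPullback K U} (φ : S ⟶ T) :
    K.map (D.comprMap φ) = (D.sumIso S).inv ≫ L.compr.map φ.snd ≫ (D.sumIso T).hom := by
  rw [comprMap_eq, map_homEquiv, truthHomSnd_comp, homEquiv_symm_snd,
    Adjunction.homEquiv_naturality_right]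
  simp

theorem map_projApp (S : StrictPullback K U) :
    K.map (D.projApp S) = (D.sumIso S).inv ≫ L.projTo S.snd S.w := by
  rw [projApp_eq, map_homEquiv_symm_fst]
  simp

theorem isIso_compr_map {S T : StrictPullback K U} (φ : S ⟶ T) [IsIso (L.compr.map φ.snd)] :
    IsIso (D.comprehension.compr.map φ) := by
  have : IsIso (K.map (D.comprMap φ)) := by
    rw [map_comprMap]
    infer_instance
  exact D.isIso_of_map (D.comprMap φ)

/-- Applying `K` and conjugating by `sumIso` turns the square into one between projections of `L`
over `K.map α`, where fullness of `L` supplies the second component. -/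
theorem exists_comprMap_eq (hL : L.IsFull) {S T : StrictPullback K U} (c : D.sum S ⟶ D.sum T)
    (α : S.fst ⟶ T.fst) (h : c ≫ D.projApp T = D.projApp S ≫ α) :
    ∃ φ : S ⟶ T, φ.fst = α ∧ D.comprMap φ = c := by
  have hK := congrArg (fun t ↦ (D.sumIso S).hom ≫ K.map t) h
  simp only [K.map_comp, map_projApp, Category.assoc, Iso.hom_inv_id_assoc] at hK
  obtain ⟨β, hβ, hβ'⟩ := hL.exists_lift S.w T.w (K.map α)
    ((D.sumIso S).hom ≫ K.map c ≫ (D.sumIso T).inv) (by simpa only [Category.assoc] using hK)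
  refine ⟨⟨α, β, hβ⟩, rfl, D.map_inj ?_⟩
  rw [map_comprMap, hβ']
  simp

theorem hom_ext_of_comprMap (hL : L.IsFull) {S T : StrictPullback K U} {φ ψ : S ⟶ T}
    (h₁ : φ.fst = ψ.fst) (h₂ : D.comprMap φ = D.comprMap ψ) : φ = ψ := by
  have h₃ := congrArg K.map h₂
  rw [map_comprMap, map_comprMap, Iso.cancel_iso_inv_left, Iso.cancel_iso_hom_right] at h₃
  have h₅ : U.IsHomLift (K.map φ.fst) φ.snd := φ.w
  have h₆ : U.IsHomLift (K.map φ.fst) ψ.snd := by rw [h₁]; exact ψ.w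
  exact StrictPullback.hom_ext h₁ (hL.hom_ext (K.map φ.fst) _ _ h₃)

theorem comprehension_isFull (hL : L.IsFull) : D.comprehension.IsFull := by
  refine ⟨⟨?_⟩, ⟨?_⟩⟩
  · intro S T h
    obtain ⟨φ, h₁, h₂⟩ := D.exists_comprMap_eq hL (S := S) (T := T) h.left h.right h.w
    exact ⟨φ, Arrow.hom_ext _ _ h₂ h₁⟩
  · intro S T φ ψ h
    exact D.hom_ext_of_comprMap hL (congrArg (fun t ↦ t.right) h) (congrArg (fun t ↦ t.left) h)

end SumClosed

/-! ### Change of base along the comprehension functor of a fibre -/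

namespace FullCartesianLawvereCategory

variable {U : E ⥤ B} (L : FullCartesianLawvereCategory U)

/-- The projection `{P} ⟶ A` of an object of the fibre over `A`. -/
def fiberProj {A : B} (P : U.Fiber A) : (L.fiberCompr A).obj P ⟶ A :=
  L.projTo (tot P) P.2

/-- The sum of a family over the comprehension of an object of the fibre over `A`. -/
def fiberSum {A : B} (S : StrictPullback (L.fiberCompr A) U) : U.Fiber A :=
  (L.sigma (L.fiberProj S.fst)).obj ⟨S.snd, S.w⟩

/-- The cocartesian morphism from a family to its sum. -/
def toFiberSum {A : B} (S : StrictPullback (L.fiberCompr A) U) : S.snd ⟶ tot (L.fiberSum S) :=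
  L.sigmaMap (L.fiberProj S.fst) ⟨S.snd, S.w⟩

instance toFiberSum_isCocartesian {A : B} (S : StrictPullback (L.fiberCompr A) U) :
    U.IsCocartesian (L.fiberProj S.fst) (L.toFiberSum S) :=
  L.sigmaMap_isCocartesian _ _

/-- The comprehension of a family is isomorphic to that of its sum. -/
def fiberSumIso (hstrong : L.VeryStrongCoproducts) {A : B}
    (S : StrictPullback (L.fiberCompr A) U) :
    L.compr.obj S.snd ≅ L.compr.obj (tot (L.fiberSum S)) :=
  haveI := hstrong.isIso_map (L.fiberProj S.fst) (L.toFiberSum S)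
  asIso (L.compr.map (L.toFiberSum S))

/-- With very strong coproducts, the fibre over `A` is a full subcategory of the slice over `A`
which is closed under sums. -/
def sumClosed (hstrong : L.VeryStrongCoproducts) (A : B) :
    SumClosed L.toComprehensionCategoryWithUnit (L.fiberCompr A) A where
  toBase P := L.fiberProj P
  map_toBase {P Q} α := by
    have h := L.compr_map_projTo (P := tot P) (Q := tot Q) P.2 Q.2 (𝟙 A) (totMap α)
    exact h.trans (Category.comp_id _)
  exists_map {P Q} b h := by
    obtain ⟨φ, hφ, hb⟩ := L.isFull.exists_lift (P := tot P) (Q := tot Q) P.2 Q.2 (𝟙 A) b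
      (h.trans (Category.comp_id _).symm)
    exact ⟨fiberHomMk φ, hb⟩
  map_inj {P Q α β} h := Functor.Fiber.hom_ext (L.isFull.hom_ext (𝟙 A) (totMap α) (totMap β) h)
  sum S := L.fiberSum S
  sumIso S := L.fiberSumIso hstrong S
  -- Naturality of the projection at the cocartesian map, which lies over `{P} ⟶ A`.
  sumIso_toBase S := L.compr_map_projTo S.w (L.fiberSum S).2 (L.fiberProj S.fst)
    (L.toFiberSum S) (h := (L.toFiberSum_isCocartesian S).toIsHomLift)

/-- The structure of a full cartesian Lawvere category on `U^A`. -/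
def indexed (hstrong : L.VeryStrongCoproducts) (A : B) :
    FullCartesianLawvereCategory (indexedFibration L.toComprehensionCategoryWithUnit A) where
  toComprehensionCategoryWithUnit := (L.sumClosed hstrong A).comprehension
  isFull := (L.sumClosed hstrong A).comprehension_isFull L.isFull
  isRightAdjoint_reindex f :=
    haveI := L.isFibered
    haveI := (L.sumClosed hstrong A).comprehension.isFibered
    StrictPullback.isRightAdjoint_reindex f (L.isRightAdjoint_reindex _)

theorem indexed_hasProducts (hprod : L.HasProducts) (hstrong : L.VeryStrongCoproducts) (A : B) :
    (L.indexed hstrong A).HasProducts := fun _ _ f ↦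
  haveI := L.isFibered
  haveI := (L.sumClosed hstrong A).comprehension.isFibered
  StrictPullback.isLeftAdjoint_reindex f (hprod ((L.fiberCompr A).map f))

/-- The second component of a cocartesian morphism of `U^A` is cocartesian for `U`, so `{-}` inverts
it, and `isIso_compr_map` lifts this back. -/
theorem indexed_veryStrongCoproducts (hstrong : L.VeryStrongCoproducts) (A : B) :
    (L.indexed hstrong A).VeryStrongCoproducts := fun X Y f P ↦ by
  have hc := (L.indexed hstrong A).sigmaMap_isCocartesian f P
  have := StrictPullback.isCocartesian_snd (h := hc)
  have := hstrong.isIso_map _ (StrictPullback.Hom.snd ((L.indexed hstrong A).sigmaMap f P))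
    (hs := this)
  exact (L.sumClosed hstrong A).isIso_compr_map _

/-- Second components, over the image pullback square in `B`, satisfy the lift form of
Beck–Chevalley for `U`; cocartesianness of the second component then returns to `U^A`. -/
theorem indexed_beckChevalley (hstrong : L.VeryStrongCoproducts) (hBC : L.BeckChevalley) (A : B) :
    (L.indexed hstrong A).BeckChevalley := by
  apply beckChevalley_of_isCocartesian
  intro W X Y Z i j f g h P' P Q' Q c t s d w hc hs hd ht
  have hc' := StrictPullback.isCartesian_snd (h := hc)
  have hs' := StrictPullback.isCocartesian_snd (h := hs)
  have hd' := StrictPullback.isCartesian_snd (h := hd)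
  have ht' := StrictPullback.isHomLift_snd (h := ht)
  have := hBC.isCocartesian (L.isPullback_fiberCompr h) c.snd t.snd s.snd d.snd
    (congrArg StrictPullback.Hom.snd w)
  exact StrictPullback.isCocartesian_of_snd (h := ht) j t

end FullCartesianLawvereCategory

end

end FibredRefinement

theorem mainTheorem4 {B : Type u₁} [Category.{v₁} B] {E : Type u₂} [Category.{v₂} E]
    (U : E ⥤ B) (L : FibredRefinement.FullCartesianLawvereCategory U)
    (hprod : L.HasProducts) (hstrong : L.VeryStrongCoproducts) (hBC : L.BeckChevalley) (A : B) :
    ∃ LA : FibredRefinement.FullCartesianLawvereCategory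
        (FibredRefinement.indexedFibration L.toComprehensionCategoryWithUnit A),
      LA.HasProducts ∧ LA.VeryStrongCoproducts ∧ LA.BeckChevalley := by
  exact ⟨L.indexed hstrong A, L.indexed_hasProducts hprod hstrong A,
    L.indexed_veryStrongCoproducts hstrong A, L.indexed_beckChevalley hstrong hBC A⟩
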